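/- There exist absolute constants $K,c>0$ such that the following holds for all integers $k,m,r\ge 1$, $n\ge 0$, $T\ge 0$ and all real matrices $A\in\mathbb{R}^{n\times n}$, $B\in\mathbb{R}^{n\times m}$, $C\in\mathbb{R}^{r\times n}$, $D\in\mathbb{R}^{r\times m}$. Consider the system $x_{t+1}=Ax_t+Bu_t+w_t$, $y_t=Cx_t+Du_t$ $(t\ge 0)$ with random initial state $x_0$. Let $\gamma>0$, and let the inputs $u_0,u_1,\dots$ be i.i.d. $N(0,\gamma^2 I_m)$. Suppose that the attacks occur with probability $0\le p<\frac{1}{4k-2}$: there are independent Bernoulli($p$) variables $\xi_0,\xi_1,\dots$ such that each $\xi_t$ is independent of the $\sigma$-algebra generated by $x_0,w_0,\dots,w_{t-1}$, and $w_t=0$ whenever $\xi_t=0$; apart from this the random vectors $w_t$ are arbitrary. Suppose also that the sequence $(\xi_t)_{t\ge0}$ is independent of the sequence $(u_t)_{t\ge0}$. Put $q=1-(1-p)^{2k-1}$ (so $q<\frac12$), $$\mathbf{U}_t^{(k)}=[u_t^T\ u_{t-1}^T\ \cdots\ u_{t-2k+1}^T]^T\in\mathbb{R}^{2km},\qquad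 v_t=\sum_{j=1}^{2k-1}CA^{j-1}w_{t-j}\in\mathbb{R}^r,$$ let $v_t^i$ be the $i$-th entry of $v_t$, and let $\mathbb{I}\{E\}$ be $1$ if the event $E$ occurs and $-1$ otherwise. Let $\delta\in(0,1]$ and suppose $$T\ \ge\ K\,\frac{k}{(1-2q)^2}\,\max\Bigl\{1,\ km\log\Bigl(\frac{km}{1-2q}\Bigr)+\log\Bigl(\frac r\delta\Bigr)\Bigr\}.$$ Then $c\,\gamma(1-2q)T>0$ and, with probability at least $1-\delta$, both of the following hold: (i) for all $s\in\mathbb{R}^{2km}$ with $\|s\|_2=1$ and all $i\in\{1,\dots,r\}$, $$\sum_{t=2k-1}^{T+2k-2}\mathbb{I}\{v_t^i=0\}\,|s^T\mathbf{U}_t^{(k)}|\ \ge\ c\,\gamma(1-2q)T;$$ (ii) if $A^{2k-1}=0$, then the Markov parameter matrix $G_k^*=[D\ \ CB\ \ CAB\ \cdots\ CA^{2k-2}B]$ is the unique minimizer over $G\in\mathbb{R}^{r\times 2km}$ of $\sum_{t=2k-1}^{T+2k-2}\|y_t-G\mathbf{U}_t^{(k)}\|_1$. -/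

import Mathlib

open MeasureTheory ProbabilityTheory
open scoped Matrix

noncomputable section

/-- The two-valued indicator of an event: `1` if the event occurs and `-1` otherwise. -/
def signIndicator (P : Prop) : ℝ :=
  open Classical in if P then 1 else -1

/-- The state trajectory `x_{t+1} = A x_t + B u_t + w_t`, started at `x0`. -/
def stateTraj {n m : ℕ} (A : Matrix (Fin n) (Fin n) ℝ) (B : Matrix (Fin n) (Fin m) ℝ)
    (x0 : Fin n → ℝ) (u : ℕ → EuclideanSpace ℝ (Fin m)) (w : ℕ → Fin n → ℝ) :
    ℕ → Fin n → ℝ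
  | 0 => x0
  | t + 1 => A *ᵥ stateTraj A B x0 u w t + B *ᵥ (u t).ofLp + w t

/-- The observation `y_t = C x_t + D u_t`. -/
def observation {n m r : ℕ} (A : Matrix (Fin n) (Fin n) ℝ) (B : Matrix (Fin n) (Fin m) ℝ)
    (C : Matrix (Fin r) (Fin n) ℝ) (D : Matrix (Fin r) (Fin m) ℝ)
    (x0 : Fin n → ℝ) (u : ℕ → EuclideanSpace ℝ (Fin m)) (w : ℕ → Fin n → ℝ) (t : ℕ) :
    Fin r → ℝ :=
  C *ᵥ stateTraj A B x0 u w t + D *ᵥ (u t).ofLp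

/-- The stacked input vector `[u_tᵀ, u_{t-1}ᵀ, …, u_{t-2k+1}ᵀ]ᵀ ∈ ℝ^{2km}`, whose coordinates are
indexed by (lag, input channel). It is used only for `t ≥ 2k - 1`. -/
def stackedInput {m : ℕ} (k : ℕ) (u : ℕ → EuclideanSpace ℝ (Fin m)) (t : ℕ) :
    EuclideanSpace ℝ (Fin (2 * k) × Fin m) :=
  WithLp.toLp 2 fun j => u (t - j.1) j.2

/-- The attack term `v_t = [C, CA, …, CA^{2k-2}] [w_{t-1}ᵀ, …, w_{t-2k+1}ᵀ]ᵀ`.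
It is used only for `t ≥ 2k - 1`. -/
def attackTerm {n r : ℕ} (k : ℕ) (A : Matrix (Fin n) (Fin n) ℝ) (C : Matrix (Fin r) (Fin n) ℝ)
    (w : ℕ → Fin n → ℝ) (t : ℕ) : Fin r → ℝ :=
  ∑ j ∈ Finset.range (2 * k - 1), (C * A ^ j) *ᵥ w (t - 1 - j)

/-- The Markov parameter matrix `[D, CB, CAB, …, CA^{2k-2}B]`, whose columns are indexed by
(block, input channel). -/
def markovMatrix {n m r : ℕ} (k : ℕ) (A : Matrix (Fin n) (Fin n) ℝ)
    (B : Matrix (Fin n) (Fin m) ℝ) (C : Matrix (Fin r) (Fin n) ℝ)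
    (D : Matrix (Fin r) (Fin m) ℝ) : Matrix (Fin r) (Fin (2 * k) × Fin m) ℝ :=
  Matrix.of fun i j =>
    if j.1.val = 0 then D i j.2 else (C * A ^ (j.1.val - 1) * B) i j.2

/-- The `ℓ₁` objective `∑_{t=2k-1}^{T+2k-2} ‖y_t - G U_t‖₁`. -/
def l1Loss {m r : ℕ} (k T : ℕ) (u : ℕ → EuclideanSpace ℝ (Fin m)) (y : ℕ → Fin r → ℝ)
    (G : Matrix (Fin r) (Fin (2 * k) × Fin m) ℝ) : ℝ :=
  ∑ t ∈ Finset.Icc (2 * k - 1) (T + 2 * k - 2),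
    ∑ i, |y t i - (G *ᵥ (stackedInput k u t).ofLp) i|

/-- The set of all solutions of the `ℓ₁`-norm estimator. -/
def l1Solutions {m r : ℕ} (k T : ℕ) (u : ℕ → EuclideanSpace ℝ (Fin m)) (y : ℕ → Fin r → ℝ) :
    Set (Matrix (Fin r) (Fin (2 * k) × Fin m) ℝ) :=
  {G | ∀ G', l1Loss k T u y G ≤ l1Loss k T u y G'}

/-- The σ-algebra `F_t` generated by `x_0, w_0, …, w_{t-1}`. -/
@[reducible]
def attackHistory {Ω : Type*} {n : ℕ} (x0 : Ω → Fin n → ℝ) (w : ℕ → Ω → Fin n → ℝ) (t : ℕ) :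
    MeasurableSpace Ω :=
  MeasurableSpace.comap x0 inferInstance ⊔
    ⨆ j ∈ Finset.range t, MeasurableSpace.comap (w j) inferInstance

/-- Attacks with probability `p` at each time: the `ξ_t` are independent Bernoulli(`p`) variables,
each `ξ_t` is independent of the past `F_t`, and there is no attack at time `t` when `ξ_t = 0`.
The attack vectors are otherwise arbitrary. -/
structure IsProbabilisticAttack {Ω : Type*} [MeasurableSpace Ω] {n : ℕ} (μ : Measure Ω)
    (p : unitInterval) (x0 : Ω → Fin n → ℝ) (w : ℕ → Ω → Fin n → ℝ) (ξ : ℕ → Ω → ℕ) :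
    Prop where
  measurable_init : Measurable x0
  measurable_attack : ∀ t, Measurable (w t)
  measurable_time : ∀ t, Measurable (ξ t)
  hasLaw : ∀ t, HasLaw (ξ t) (bernoulliMeasure 1 0 p) μ
  iIndep : iIndepFun ξ μ
  indep_history : ∀ t, Indep (MeasurableSpace.comap (ξ t) inferInstance) (attackHistory x0 w t) μ
  eq_zero : ∀ t ω, ξ t ω = 0 → w t ω = 0

/-- The inputs `u_0, u_1, …` are i.i.d. with law `N(0, γ² I_m)`. -/
structure IsGaussianInput {Ω : Type*} [MeasurableSpace Ω] {m : ℕ} (μ : Measure Ω) (γ : ℝ)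
    (u : ℕ → Ω → EuclideanSpace ℝ (Fin m)) : Prop where
  measurable : ∀ t, Measurable (u t)
  hasLaw : ∀ t, HasLaw (u t) (multivariateGaussian 0 (γ ^ 2 • (1 : Matrix (Fin m) (Fin m) ℝ))) μ
  iIndep : iIndepFun u μ

end

/-! ### Independence of paired and blocked sequences. -/

section Independence

variable {Ω : Type*} [MeasurableSpace Ω] {μ : Measure Ω}

/-! Put `β = 1 - 2q`. The attack term vanishes whenever its window of `2k - 1` times is free of
attacks, so the sign in (i) dominates `windowSign`. That sign depends only on `ξ`; it is therefore
independent of the inputs, has mean `β`, and serves every row at once.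

For a fixed unit `s`, `sᵀU_t / γ` is standard Gaussian, so each product of sign and absolute value
has mean at least `βγ/3`. The term with index `i` sees only `(u, ξ)` at times `i, …, i + 2k - 1`;
along each residue class mod `2k` the terms are independent, and a Chernoff bound with a union over
classes gives `measureReal_sum_windowSign_mul_abs_lt_le`.

A grid makes this uniform in `s`: rounding costs at most the mesh times the sum of all coordinates
of the `U_t` in absolute value, which `measureReal_lt_sum_abs_le` controls. The lower bound on `T`
pays for the union bound (`union_bound_le`).

Part (ii) is then deterministic. If `A^(2k-1) = 0`, then `y_t = G* U_t + v_t` exactly, and by the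
triangle inequality the loss at `G` exceeds the loss at `G*` by at least the sums in (i) with the
rows of `G - G*` in place of `s` (`l1Solutions_eq_singleton`). -/

theorem iIndepFun_prodMk_of_indepFun {ι α β : Type*} [MeasurableSpace α] [MeasurableSpace β]
    {X : ι → Ω → α} {Y : ι → Ω → β} (mX : ∀ i, Measurable (X i)) (mY : ∀ i, Measurable (Y i))
    (hX : iIndepFun X μ) (hY : iIndepFun Y μ)
    (hXY : IndepFun (fun ω i => X i ω) (fun ω i => Y i ω) μ) :
    iIndepFun (fun i ω => (X i ω, Y i ω)) μ := by
  classical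
  rw [iIndepFun_iff_iIndep]
  -- Rectangles form a π-system generating the product σ-algebra, so factorization need only be
  -- checked on them.
  refine iIndepSets.iIndep
    (fun i => ((mX i).prodMk (mY i)).comap_le)
    (fun i => {s | ∃ t ∈ Set.image2 (· ×ˢ ·) {a : Set α | MeasurableSet a}
      {b : Set β | MeasurableSet b}, (fun ω => (X i ω, Y i ω)) ⁻¹' t = s})
    (fun i => isPiSystem_prod.comap _) (fun i => ?_) ?_
  · rw [← generateFrom_prod, MeasurableSpace.comap_generateFrom]
    rfl
  · rw [iIndepSets_iff]
    intro S f hf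
    have hf' : ∀ i : ι, ∃ a : Set α, ∃ b : Set β, MeasurableSet a ∧ MeasurableSet b ∧
        (i ∈ S → f i = X i ⁻¹' a ∩ Y i ⁻¹' b) := by
      intro i
      by_cases hi : i ∈ S
      · obtain ⟨t, ⟨a, ha, b, hb, rfl⟩, ht⟩ := hf i hi
        exact ⟨a, b, ha, hb, fun _ => ht.symm⟩
      · exact ⟨∅, ∅, .empty, .empty, fun h => absurd h hi⟩
    choose a b ha hb hab using hf'
    have h1 : (⋂ i ∈ S, f i) = (⋂ i ∈ S, X i ⁻¹' a i) ∩ (⋂ i ∈ S, Y i ⁻¹' b i) := by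
      simp only [← Set.iInter_inter_distrib]
      exact Set.iInter₂_congr hab
    have h2 : ∀ i ∈ S, μ (f i) = μ (X i ⁻¹' a i) * μ (Y i ⁻¹' b i) := by
      intro i hi
      rw [hab i hi]
      have := hXY.comp (measurable_pi_apply i) (measurable_pi_apply i)
      exact this.measure_inter_preimage_eq_mul _ _ (ha i) (hb i)
    rw [h1, Finset.prod_congr rfl h2, Finset.prod_mul_distrib,
      ← hX.measure_inter_preimage_eq_mul S (fun i _ => ha i),
      ← hY.measure_inter_preimage_eq_mul S (fun i _ => hb i)]
    have hA : MeasurableSet (⋂ i ∈ S, (fun x : ι → α => x i) ⁻¹' a i) :=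
      Finset.measurableSet_biInter _ fun i _ => measurable_pi_apply i (ha i)
    have hB : MeasurableSet (⋂ i ∈ S, (fun x : ι → β => x i) ⁻¹' b i) :=
      Finset.measurableSet_biInter _ fun i _ => measurable_pi_apply i (hb i)
    have := hXY.measure_inter_preimage_eq_mul _ _ hA hB
    simp only [Set.preimage_iInter₂] at this
    exact this

/-- Independence says that the joint law is a product measure, and currying turns a product over a
sigma type into a product of products. -/
theorem iIndepFun.sigma_curry {ι : Type*} {κ : ι → Type*} {𝓧 : (i : ι) → κ i → Type*}
    [∀ i j, MeasurableSpace (𝓧 i j)] {X : (p : (i : ι) × κ i) → Ω → 𝓧 p.1 p.2}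
    (mX : ∀ p, Measurable (X p)) (h : iIndepFun X μ) :
    iIndepFun (fun i ω => fun j : κ i => X ⟨i, j⟩ ω) μ := by
  have := h.isProbabilityMeasure
  have hp : ∀ i j, IsProbabilityMeasure (μ.map (X ⟨i, j⟩)) :=
    fun i j => Measure.isProbabilityMeasure_map (mX _).aemeasurable
  have hc : ∀ i, iIndepFun (fun j : κ i => X ⟨i, j⟩) μ := fun i =>
    h.precomp (g := fun j : κ i => (⟨i, j⟩ : (i : ι) × κ i)) sigma_mk_injective
  rw [iIndepFun_iff_map_fun_eq_infinitePi_map (fun i => measurable_pi_lambda _ fun j => mX _)]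
  have h1 : (fun ω i (j : κ i) => X ⟨i, j⟩ ω) =
      (MeasurableEquiv.piCurry 𝓧) ∘ (fun ω p => X p ω) := by
    ext; simp [Sigma.curry]
  rw [h1, ← Measure.map_map (by fun_prop) (measurable_pi_lambda _ mX),
    h.map_fun_eq_infinitePi_map mX, Measure.infinitePi_map_piCurry (fun i j => μ.map (X ⟨i, j⟩))]
  congr 1
  ext1 i
  rw [(hc i).map_fun_eq_infinitePi_map (fun j => mX _)]

/-- Disjoint consecutive blocks of length `L` of an independent sequence are independent. -/
theorem iIndepFun_blocks {α : Type*} [MeasurableSpace α] {Z : ℕ → Ω → α}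
    (mZ : ∀ i, Measurable (Z i)) (hZ : iIndepFun Z μ) (L j : ℕ) :
    iIndepFun (fun a ω => fun l : Fin L => Z (j + L * a + l) ω) μ := by
  refine iIndepFun.sigma_curry (ι := ℕ) (κ := fun _ => Fin L) (𝓧 := fun _ _ => α)
    (X := fun p => Z (j + L * p.1 + p.2)) (fun p => mZ _) ?_
  refine hZ.precomp (g := fun p : (_ : ℕ) × Fin L => j + L * p.1 + p.2) ?_
  rintro ⟨a, l⟩ ⟨b, l'⟩ h
  have h' : L * a + l = L * b + l' := by simpa [add_assoc] using h
  have hL : 0 < L := l.pos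
  have ha : a = b := by
    have := congrArg (· / L) h'
    simpa [Nat.mul_add_div hL, Nat.div_eq_of_lt l.isLt, Nat.div_eq_of_lt l'.isLt] using this
  subst ha
  have : l = l' := Fin.ext (by omega)
  rw [this]

end Independence

/-! ### Lower-tail bound for sequences independent along residue classes. -/

section Tail

variable {Ω : Type*} [MeasurableSpace Ω] {μ : Measure Ω}

theorem sum_range_eq_sum_residues {M : Type*} [AddCommMonoid M] {L : ℕ} (hL : 0 < L) (T : ℕ)
    (f : ℕ → M) :
    ∑ i ∈ Finset.range T, f i = ∑ j ∈ Finset.range L,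
      ∑ a ∈ (Finset.range T).filter (fun a => j + L * a < T), f (j + L * a) := by
  rw [Finset.sum_sigma']
  symm
  refine Finset.sum_bij' (fun p _ => p.1 + L * p.2) (fun i _ => ⟨i % L, i / L⟩) ?_ ?_ ?_ ?_ ?_
  · rintro ⟨j, a⟩ h
    simp only [Finset.mem_sigma, Finset.mem_filter, Finset.mem_range] at h ⊢
    exact h.2.2
  · intro i h
    simp only [Finset.mem_sigma, Finset.mem_filter, Finset.mem_range] at h ⊢
    refine ⟨Nat.mod_lt _ hL, lt_of_le_of_lt (Nat.div_le_self _ _) h, ?_⟩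
    rwa [Nat.mod_add_div]
  · rintro ⟨j, a⟩ h
    simp only [Finset.mem_sigma, Finset.mem_range] at h
    simp [Nat.add_mul_mod_self_left, Nat.mod_eq_of_lt h.1, Nat.add_mul_div_left _ _ hL,
      Nat.div_eq_of_lt h.1]
  · intro i h
    exact Nat.mod_add_div i L
  · intros
    rfl

/-- A negative total forces a negative sum over some residue class mod `L`. Each class has at least
`T / L` independent terms, so Chernoff at level `0` bounds it by `ρ ^ (T / L)`; the factor `L`
counts the classes. -/
theorem measureReal_sum_neg_le [IsProbabilityMeasure μ] {L : ℕ} (hL : 0 < L) (T : ℕ)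
    {X : ℕ → Ω → ℝ} (mX : ∀ i, Measurable (X i))
    (hind : ∀ j, iIndepFun (fun a => X (j + L * a)) μ) {θ ρ : ℝ} (hθ : 0 ≤ θ) (hρ1 : ρ ≤ 1)
    (hint : ∀ i, Integrable (fun ω => Real.exp (-θ * X i ω)) μ)
    (hmgf : ∀ i, mgf (X i) μ (-θ) ≤ ρ) :
    μ.real {ω | ∑ i ∈ Finset.range T, X i ω < 0} ≤ L * ρ ^ (T / L) := by
  set A : ℕ → Finset ℕ := fun j => (Finset.range T).filter (fun a => j + L * a < T) with hA
  have hρ0 : 0 ≤ ρ := mgf_nonneg.trans (hmgf 0)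
  have hsub : {ω | ∑ i ∈ Finset.range T, X i ω < 0} ⊆
      ⋃ j ∈ Finset.range L, {ω | (∑ a ∈ A j, X (j + L * a)) ω ≤ 0} := by
    intro ω hω
    rw [Set.mem_ofPred_eq, sum_range_eq_sum_residues hL] at hω
    obtain ⟨j, hj, hlt⟩ := Finset.exists_lt_of_sum_lt
      (hω.trans_eq (Finset.sum_const_zero (s := Finset.range L)).symm)
    simp only [Set.mem_iUnion]
    refine ⟨j, hj, ?_⟩
    simpa using hlt.le
  refine (measureReal_mono hsub (measure_ne_top _ _)).trans ?_
  refine (measureReal_biUnion_finset_le _ _).trans ?_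
  have hj : ∀ j ∈ Finset.range L,
      μ.real {ω | (∑ a ∈ A j, X (j + L * a)) ω ≤ 0} ≤ ρ ^ (T / L) := by
    intro j hj
    have hcard : T / L ≤ (A j).card := by
      have : Finset.range (T / L) ⊆ A j := by
        intro a ha
        rw [Finset.mem_range] at ha hj
        have h1 : (a + 1) * L ≤ T := (Nat.le_div_iff_mul_le hL).1 ha
        have h2 : a ≤ L * a := Nat.le_mul_of_pos_left _ hL
        simp only [hA, Finset.mem_filter, Finset.mem_range]
        constructor <;> nlinarith
      simpa using Finset.card_le_card this
    refine (measure_le_le_exp_mul_mgf 0 (neg_nonpos.2 hθ)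
      ((hind j).integrable_exp_mul_sum (fun a => mX _) fun a _ => hint _)).trans ?_
    rw [(hind j).mgf_sum (fun a => mX _)]
    simp only [mul_zero, Real.exp_zero, one_mul]
    calc ∏ a ∈ A j, mgf (X (j + L * a)) μ (-θ) ≤ ∏ a ∈ A j, ρ :=
          Finset.prod_le_prod (fun _ _ => mgf_nonneg) fun a _ => hmgf _
      _ = ρ ^ (A j).card := by simp
      _ ≤ ρ ^ (T / L) := pow_le_pow_of_le_one hρ0 hρ1 hcard
  refine (Finset.sum_le_sum hj).trans ?_
  simp

end Tail

/-! ### Moments of the standard Gaussian. -/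

section GaussianMoments

/-- Pointwise `1 - cos x ≤ |x|`, and the characteristic function at `1` gives `E cos = exp(-1/2) ≤
2/3`. This avoids computing the exact value of `E|Z|`. -/
theorem one_third_le_integral_abs_gaussianReal :
    1 / 3 ≤ ∫ x, |x| ∂(gaussianReal 0 1) := by
  have hcos : ∫ x, Real.cos x ∂(gaussianReal 0 1) = Real.exp (-(1 / 2)) := by
    have h := charFun_gaussianReal (μ := 0) (v := 1) 1
    rw [charFun_apply_real] at h
    have h2 := congrArg Complex.re h
    have hint : Integrable (fun x : ℝ => Complex.exp ((1 : ℝ) * x * Complex.I))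
        (gaussianReal 0 1) := by
      refine Integrable.of_bound (C := 1) (by fun_prop) (Filter.Eventually.of_forall fun x => ?_)
      have : ((1 : ℝ) : ℂ) * x * Complex.I = (x : ℂ) * Complex.I := by simp
      rw [this, Complex.norm_exp_ofReal_mul_I]
    have h3 : ∫ x, (Complex.exp ((1 : ℝ) * x * Complex.I)).re ∂(gaussianReal 0 1)
        = (∫ x, Complex.exp ((1 : ℝ) * x * Complex.I) ∂(gaussianReal 0 1)).re :=
      integral_re hint
    rw [← h3] at h2
    have h4 : ∀ x : ℝ, (Complex.exp ((1 : ℝ) * x * Complex.I)).re = Real.cos x := by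
      intro x
      rw [show ((1 : ℝ) : ℂ) * x * Complex.I = (x : ℂ) * Complex.I by simp,
        Complex.exp_ofReal_mul_I_re]
    simp only [h4] at h2
    rw [h2]
    have : ((1 : ℝ) : ℂ) * ((0 : ℝ) : ℂ) * Complex.I - ((1 : NNReal) : ℂ) * ((1 : ℝ) : ℂ) ^ 2 / 2
        = ((-(1 / 2) : ℝ) : ℂ) := by push_cast; simp
    rw [this, Complex.exp_ofReal_re]
  have hexp : Real.exp (-(1 / 2)) ≤ 2 / 3 := by
    rw [Real.exp_neg, inv_le_comm₀ (Real.exp_pos _) (by norm_num)]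
    have := Real.add_one_le_exp (1 / 2 : ℝ)
    norm_num at this ⊢
    linarith
  have hintcos : Integrable (fun x : ℝ => Real.cos x) (gaussianReal 0 1) :=
    Integrable.of_bound (C := 1) (by fun_prop)
      (Filter.Eventually.of_forall fun x => by simpa using Real.abs_cos_le_one x)
  have hintabs : Integrable (fun x : ℝ => |x|) (gaussianReal 0 1) :=
    ((memLp_id_gaussianReal 1).integrable le_rfl).abs
  calc (1 / 3 : ℝ) ≤ 1 - Real.exp (-(1 / 2)) := by linarith
    _ = ∫ x, (1 - Real.cos x) ∂(gaussianReal 0 1) := by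
        rw [integral_sub (integrable_const _) hintcos, hcos]; simp
    _ ≤ ∫ x, |x| ∂(gaussianReal 0 1) := by
        refine integral_mono ((integrable_const _).sub hintcos) hintabs fun x => ?_
        have h1 : 1 - x ^ 2 / 2 ≤ Real.cos x := Real.one_sub_sq_div_two_le_cos
        have h2 := Real.neg_one_le_cos x
        rcases le_total |x| 2 with h | h
        · have := sq_abs x
          nlinarith [abs_nonneg x]
        · linarith

theorem integral_cosh_gaussianReal (θ : ℝ) :
    Integrable (fun x => Real.cosh (θ * x)) (gaussianReal 0 1) ∧
      ∫ x, Real.cosh (θ * x) ∂(gaussianReal 0 1) = Real.exp (θ ^ 2 / 2) := by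
  have hi : ∀ t : ℝ, Integrable (fun x => Real.exp (t * x)) (gaussianReal 0 1) :=
    fun t => integrable_exp_mul_gaussianReal t
  have hm : ∀ t : ℝ, ∫ x, Real.exp (t * x) ∂(gaussianReal 0 1) = Real.exp (t ^ 2 / 2) := by
    intro t
    have := congrFun (mgf_id_gaussianReal (μ := 0) (v := 1)) t
    simpa [mgf] using this
  have h : (fun x => Real.cosh (θ * x)) =
      fun x => (Real.exp (θ * x) + Real.exp (-θ * x)) / 2 := by
    ext x; rw [Real.cosh_eq, neg_mul]
  rw [h]
  refine ⟨((hi θ).add (hi (-θ))).div_const 2, ?_⟩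
  rw [integral_div, integral_add (hi θ) (hi (-θ)), hm, hm, neg_sq]
  ring

theorem integrable_sinh_abs_gaussianReal (θ : ℝ) :
    Integrable (fun x => Real.sinh (θ * |x|)) (gaussianReal 0 1) := by
  refine (integral_cosh_gaussianReal θ).1.mono (by fun_prop)
    (Filter.Eventually.of_forall fun x => ?_)
  have h : Real.cosh (θ * x) = Real.cosh (θ * |x|) := by
    rw [← Real.cosh_abs (θ * x), ← Real.cosh_abs (θ * |x|), abs_mul, abs_mul, abs_abs]
  rw [Real.norm_eq_abs, Real.norm_eq_abs, abs_of_pos (Real.cosh_pos _), h, abs_le]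
  have h1 := Real.sinh_lt_cosh (θ * |x|)
  have h2 := Real.sinh_lt_cosh (-(θ * |x|))
  rw [Real.sinh_neg, Real.cosh_neg] at h2
  constructor <;> linarith

theorem le_integral_sinh_abs_gaussianReal {θ : ℝ} (hθ : 0 ≤ θ) :
    θ / 3 ≤ ∫ x, Real.sinh (θ * |x|) ∂(gaussianReal 0 1) := by
  have hintabs : Integrable (fun x : ℝ => |x|) (gaussianReal 0 1) :=
    ((memLp_id_gaussianReal 1).integrable le_rfl).abs
  calc θ / 3 ≤ θ * ∫ x, |x| ∂(gaussianReal 0 1) := by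
        have := mul_le_mul_of_nonneg_left one_third_le_integral_abs_gaussianReal hθ
        linarith
    _ = ∫ x, θ * |x| ∂(gaussianReal 0 1) := (integral_const_mul _ _).symm
    _ ≤ _ := integral_mono (hintabs.const_mul θ) (integrable_sinh_abs_gaussianReal θ) fun x =>
        Real.self_le_sinh_iff.2 (by positivity)

end GaussianMoments

/-! ### Exponential moments of a single term. -/

section OneStep

variable {Ω : Type*} [MeasurableSpace Ω] {μ : Measure Ω}

theorem ProbabilityTheory.HasLaw.integrable_comp {α : Type*} [MeasurableSpace α]
    {ν : Measure α} {Z : Ω → α} (hZ : HasLaw Z ν μ) {f : α → ℝ} (hf : Integrable f ν) :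
    Integrable (fun ω => f (Z ω)) μ := by
  rw [← hZ.map_eq] at hf
  exact hf.comp_aemeasurable hZ.aemeasurable

/-- The right side is affine in the sign `a`, so for `a` independent of `z` its expectation needs
only `E a`. -/
theorem exp_neg_sign_mul_abs {a θ : ℝ} (ha : a = 1 ∨ a = -1) (z : ℝ) :
    Real.exp (-θ * (a * |z|)) = Real.cosh (θ * z) - a * Real.sinh (θ * |z|) := by
  have h : Real.cosh (θ * z) = Real.cosh (θ * |z|) := by
    rw [← Real.cosh_abs (θ * z), ← Real.cosh_abs (θ * |z|), abs_mul, abs_mul, abs_abs]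
  rw [h]
  rcases ha with rfl | rfl
  · rw [one_mul, one_mul, Real.cosh_sub_sinh, neg_mul]
  · rw [neg_one_mul, neg_one_mul, sub_neg_eq_add, Real.cosh_add_sinh]
    ring_nf

/-- The mean of `a|Z|` is at least `β/3`; centring at half of this leaves room for the exponential
bound. With `θ = β/12` the exponent is `θ² - βθ/3 + βθ/6 = -β²/144`. -/
theorem mgf_sign_mul_abs_gaussian_le {Z a : Ω → ℝ} (hZ : HasLaw Z (gaussianReal 0 1) μ)
    (ma : Measurable a) (ha : ∀ ω, a ω = 1 ∨ a ω = -1) (hind : IndepFun a Z μ)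
    {β : ℝ} (hβ0 : 0 ≤ β) (hβ1 : β ≤ 1) (hE : ∫ ω, a ω ∂μ = β) :
    Integrable (fun ω => Real.exp (-(β / 12) * (a ω * |Z ω| - β / 6))) μ ∧
      mgf (fun ω => a ω * |Z ω| - β / 6) μ (-(β / 12)) ≤ Real.exp (-(β ^ 2 / 144)) := by
  set θ := β / 12 with hθ
  have hθ0 : 0 ≤ θ := by positivity
  have hfun : (fun ω => Real.exp (-θ * (a ω * |Z ω| - β / 6))) = fun ω =>
      Real.exp (θ * (β / 6)) * (Real.cosh (θ * Z ω) - a ω * Real.sinh (θ * |Z ω|)) := by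
    ext ω
    rw [← exp_neg_sign_mul_abs (ha ω), ← Real.exp_add]
    ring_nf
  have hc : Integrable (fun ω => Real.cosh (θ * Z ω)) μ :=
    hZ.integrable_comp (integral_cosh_gaussianReal θ).1
  have hs : Integrable (fun ω => Real.sinh (θ * |Z ω|)) μ :=
    hZ.integrable_comp (integrable_sinh_abs_gaussianReal θ)
  have has : Integrable (fun ω => a ω * Real.sinh (θ * |Z ω|)) μ := by
    refine hs.bdd_mul (c := 1) ma.aestronglyMeasurable (Filter.Eventually.of_forall fun ω => ?_)
    rcases ha ω with h | h <;> simp [h]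
  have hEc : ∫ ω, Real.cosh (θ * Z ω) ∂μ = Real.exp (θ ^ 2 / 2) := by
    rw [← (integral_cosh_gaussianReal θ).2]
    exact hZ.integral_comp (f := fun x => Real.cosh (θ * x)) (by fun_prop)
  have hEs : θ / 3 ≤ ∫ ω, Real.sinh (θ * |Z ω|) ∂μ := by
    refine (le_integral_sinh_abs_gaussianReal hθ0).trans_eq ?_
    exact (hZ.integral_comp (f := fun x => Real.sinh (θ * |x|)) (by fun_prop)).symm
  have hEas : ∫ ω, a ω * Real.sinh (θ * |Z ω|) ∂μ = β * ∫ ω, Real.sinh (θ * |Z ω|) ∂μ := by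
    have h := hind.comp (φ := id) (ψ := fun x : ℝ => Real.sinh (θ * |x|)) measurable_id
      (by fun_prop)
    rw [← hE]
    exact h.integral_fun_mul_eq_mul_integral ma.aestronglyMeasurable hs.aestronglyMeasurable
  refine ⟨by rw [hfun]; exact (hc.sub has).const_mul _, ?_⟩
  rw [mgf, hfun, integral_const_mul, integral_sub hc has, hEc, hEas]
  -- From `exp x ≤ 1 / (1 - x) ≤ 1 + 2x` for `0 ≤ x ≤ 1/2`.
  have hexp : Real.exp (θ ^ 2 / 2) ≤ 1 + θ ^ 2 := by
    have hx : θ ^ 2 / 2 ≤ 1 / 2 := by nlinarith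
    have h := Real.exp_bound_div_one_sub_of_interval (x := θ ^ 2 / 2) (by positivity)
      (by linarith)
    refine h.trans ?_
    rw [div_le_iff₀ (by linarith)]
    nlinarith [sq_nonneg θ]
  have h1 : Real.exp (θ ^ 2 / 2) - β * ∫ ω, Real.sinh (θ * |Z ω|) ∂μ ≤
      Real.exp (θ ^ 2 - β * (θ / 3)) := by
    have := Real.add_one_le_exp (θ ^ 2 - β * (θ / 3))
    nlinarith [mul_le_mul_of_nonneg_left hEs hβ0]
  refine (mul_le_mul_of_nonneg_left h1 (Real.exp_pos _).le).trans_eq ?_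
  rw [← Real.exp_add, hθ]
  ring_nf

/-- From `exp |z| ≤ 2 cosh z` the moment is at most `2 exp(-3 + 1/2)`, and `2 ≤ exp(3/2)`. -/
theorem mgf_const_sub_abs_gaussian_le {Z : Ω → ℝ} (hZ : HasLaw Z (gaussianReal 0 1) μ) :
    Integrable (fun ω => Real.exp (-1 * (3 - |Z ω|))) μ ∧
      mgf (fun ω => 3 - |Z ω|) μ (-1) ≤ Real.exp (-1) := by
  have hc : Integrable (fun ω => Real.cosh (1 * Z ω)) μ :=
    hZ.integrable_comp (integral_cosh_gaussianReal 1).1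
  have hEc : ∫ ω, Real.cosh (1 * Z ω) ∂μ = Real.exp (1 ^ 2 / 2) := by
    rw [← (integral_cosh_gaussianReal 1).2]
    exact hZ.integral_comp (f := fun x => Real.cosh (1 * x)) (by fun_prop)
  have hle : ∀ ω, Real.exp (-1 * (3 - |Z ω|)) ≤ 2 * Real.exp (-3) * Real.cosh (1 * Z ω) := by
    intro ω
    rw [← Real.cosh_abs, one_mul, Real.cosh_eq,
      show -1 * (3 - |Z ω|) = -3 + |Z ω| by ring, Real.exp_add]
    nlinarith [Real.exp_pos (-3), Real.exp_pos (-|Z ω|),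
      mul_pos (Real.exp_pos (-3)) (Real.exp_pos (-|Z ω|))]
  have hint : Integrable (fun ω => Real.exp (-1 * (3 - |Z ω|))) μ := by
    have hm : AEMeasurable Z μ := hZ.aemeasurable
    refine (hc.const_mul (2 * Real.exp (-3))).mono' (by fun_prop)
      (Filter.Eventually.of_forall fun ω => ?_)
    rw [Real.norm_eq_abs, Real.abs_exp]
    exact hle ω
  refine ⟨hint, (integral_mono hint (hc.const_mul _) hle).trans ?_⟩
  rw [integral_const_mul, hEc]
  have h2 : (2 : ℝ) ≤ Real.exp (3 / 2) := by
    have := Real.add_one_le_exp (3 / 2 : ℝ); linarith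
  calc 2 * Real.exp (-3) * Real.exp (1 ^ 2 / 2)
      ≤ Real.exp (3 / 2) * Real.exp (-3) * Real.exp (1 ^ 2 / 2) := by gcongr
    _ = Real.exp (-1) := by rw [← Real.exp_add, ← Real.exp_add]; norm_num

end OneStep

noncomputable section

/-! ### Gaussian law of the stacked input in a fixed direction. -/

section GaussianWindow

variable {Ω : Type*} [MeasurableSpace Ω] {μ : Measure Ω} {m k : ℕ} {γ : ℝ}
  {u : ℕ → Ω → EuclideanSpace ℝ (Fin m)}

/-- The block of `s` that multiplies the input of lag `j`. -/
def lagBlock (s : EuclideanSpace ℝ (Fin (2 * k) × Fin m)) (j : Fin (2 * k)) :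
    EuclideanSpace ℝ (Fin m) :=
  WithLp.toLp 2 fun c => s (j, c)

theorem inner_stackedInput (s : EuclideanSpace ℝ (Fin (2 * k) × Fin m))
    (v : ℕ → EuclideanSpace ℝ (Fin m)) (t : ℕ) :
    inner ℝ s (stackedInput k v t) = ∑ j, inner ℝ (lagBlock s j) (v (t - j)) := by
  simp [PiLp.inner_apply, stackedInput, lagBlock, Fintype.sum_prod_type]

theorem sum_norm_sq_lagBlock (s : EuclideanSpace ℝ (Fin (2 * k) × Fin m)) :
    ∑ j, ‖lagBlock s j‖ ^ 2 = ‖s‖ ^ 2 := by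
  simp [EuclideanSpace.norm_sq_eq, lagBlock, Fintype.sum_prod_type]

theorem charFun_map_inner {E : Type*} [NormedAddCommGroup E] [InnerProductSpace ℝ E]
    [MeasurableSpace E] [BorelSpace E] [SecondCountableTopology E] {X : Ω → E}
    (hX : Measurable X) (s : E) (x : ℝ) :
    charFun (μ.map fun ω => inner ℝ s (X ω)) x = charFun (μ.map X) (x • s) := by
  have hm : Measurable fun ω => inner ℝ s (X ω) := by fun_prop
  rw [charFun_apply, charFun_apply, integral_map hm.aemeasurable (by fun_prop),
    integral_map hX.aemeasurable (by fun_prop)]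
  congr 1
  ext ω
  simp [real_inner_comm, inner_smul_right]

theorem charFun_gaussianInput (hu : IsGaussianInput μ γ u) (t : ℕ) (x : EuclideanSpace ℝ (Fin m)) :
    charFun (μ.map (u t)) x = Complex.exp (-((γ ^ 2 * ‖x‖ ^ 2 / 2 : ℝ) : ℂ)) := by
  have hS : (γ ^ 2 • (1 : Matrix (Fin m) (Fin m) ℝ)).PosSemidef :=
    Matrix.PosSemidef.one.smul (sq_nonneg γ)
  rw [(hu.hasLaw t).map_eq, charFun_multivariateGaussian hS]
  congr 1
  have h : x.ofLp ⬝ᵥ (γ ^ 2 • (1 : Matrix (Fin m) (Fin m) ℝ)) *ᵥ x.ofLp = γ ^ 2 * ‖x‖ ^ 2 := by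
    rw [Matrix.smul_mulVec, Matrix.one_mulVec, dotProduct_smul, EuclideanSpace.norm_sq_eq]
    simp [dotProduct, sq]
  rw [h]
  simp

theorem hasLaw_inner_stackedInput (hu : IsGaussianInput μ γ u) (hγ : 0 < γ) {t : ℕ}
    (ht : 2 * k - 1 ≤ t) {s : EuclideanSpace ℝ (Fin (2 * k) × Fin m)} (hs : ‖s‖ = 1) :
    HasLaw (fun ω => inner ℝ s (stackedInput k (fun j => u j ω) t) / γ) (gaussianReal 0 1) μ := by
  have := hu.iIndep.isProbabilityMeasure
  have hfun : (fun ω => inner ℝ s (stackedInput k (fun j => u j ω) t) / γ) =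
      fun ω => ∑ j : Fin (2 * k), inner ℝ (γ⁻¹ • lagBlock s j) (u (t - j) ω) := by
    ext ω
    rw [inner_stackedInput, div_eq_inv_mul, Finset.mul_sum]
    simp [inner_smul_left]
  have hmeas : ∀ t, Measurable (u t) := hu.measurable
  have hm : ∀ j : Fin (2 * k), Measurable fun ω => inner ℝ (γ⁻¹ • lagBlock s j) (u (t - j) ω) :=
    fun j => by fun_prop
  rw [hfun]
  refine ⟨by fun_prop, ?_⟩
  have hind : iIndepFun (fun (j : Fin (2 * k)) ω =>
      inner ℝ (γ⁻¹ • lagBlock s j) (u (t - j) ω)) μ := by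
    -- The lags pick distinct times because `t ≥ 2k - 1` keeps the natural subtraction from
    -- truncating.
    have h1 := hu.iIndep.precomp (g := fun j : Fin (2 * k) => t - (j : ℕ)) (by
      intro a b hab
      have ha := a.isLt
      have hb := b.isLt
      simp only at hab
      exact Fin.ext (by omega))
    exact h1.comp (fun j x => inner ℝ (γ⁻¹ • lagBlock s j) x) (fun j => by fun_prop)
  have : IsProbabilityMeasure (μ.map fun ω =>
      ∑ j : Fin (2 * k), inner ℝ (γ⁻¹ • lagBlock s j) (u (t - j) ω)) :=
    Measure.isProbabilityMeasure_map (by fun_prop)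
  refine Measure.ext_of_charFun ?_
  rw [hind.charFun_map_fun_sum_eq_prod fun j => (hm j).aemeasurable]
  ext x
  rw [Finset.prod_apply, charFun_gaussianReal]
  simp_rw [charFun_map_inner (hmeas _), charFun_gaussianInput hu]
  rw [← Complex.exp_sum]
  congr 1
  have h2 : ∀ j : Fin (2 * k), γ ^ 2 * ‖x • γ⁻¹ • lagBlock s j‖ ^ 2 / 2 =
      x ^ 2 / 2 * ‖lagBlock s j‖ ^ 2 := by
    intro j
    rw [norm_smul, norm_smul, mul_pow, mul_pow, Real.norm_eq_abs, Real.norm_eq_abs, sq_abs, sq_abs]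
    field_simp
  simp_rw [h2]
  rw [Finset.sum_neg_distrib, ← Complex.ofReal_sum, ← Finset.mul_sum, sum_norm_sq_lagBlock, hs]
  simp

end GaussianWindow

/-! ### Attack-free windows and the sign they force. -/

section AttackSign

variable {Ω : Type*} [MeasurableSpace Ω] {μ : Measure Ω} {n r k : ℕ}

/-- `1` if there is no attack time in the window `i, …, i + 2k - 2`, and `-1` otherwise. -/
def windowSign (k : ℕ) (x : ℕ → ℕ) (i : ℕ) : ℝ :=
  signIndicator (∀ l < 2 * k - 1, x (i + l) = 0)

theorem signIndicator_eq_or (P : Prop) : signIndicator P = 1 ∨ signIndicator P = -1 := by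
  unfold signIndicator
  split_ifs <;> simp

theorem signIndicator_mono {P Q : Prop} (h : P → Q) : signIndicator P ≤ signIndicator Q := by
  unfold signIndicator
  by_cases hP : P
  · simp [hP, h hP]
  · by_cases hQ : Q <;> simp [hP, hQ]

theorem abs_signIndicator (P : Prop) : |signIndicator P| = 1 := by
  rcases signIndicator_eq_or P with h | h <;> simp [h]

theorem measurable_signIndicator {α : Type*} [MeasurableSpace α] {P : α → Prop}
    (hP : MeasurableSet {x | P x}) : Measurable fun x => signIndicator (P x) := by
  classical
  unfold signIndicator
  exact Measurable.ite hP measurable_const measurable_const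

theorem integral_signIndicator [IsProbabilityMeasure μ] {P : Ω → Prop}
    (hP : MeasurableSet {ω | P ω}) :
    ∫ ω, signIndicator (P ω) ∂μ = 2 * μ.real {ω | P ω} - 1 := by
  have h : (fun ω => signIndicator (P ω)) =
      fun ω => 2 * ({ω | P ω}.indicator 1 ω : ℝ) - 1 := by
    ext ω
    by_cases hω : P ω <;> simp [signIndicator, hω]; norm_num
  have hi : Integrable (fun ω => ({ω | P ω}.indicator 1 ω : ℝ)) μ :=
    (integrable_const (1 : ℝ)).indicator hP
  rw [h, integral_sub (hi.const_mul 2) (integrable_const _), integral_const_mul,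
    integral_indicator_one hP]
  simp

theorem integral_windowSign [IsProbabilityMeasure μ] {p : unitInterval} {x0 : Ω → Fin n → ℝ}
    {w : ℕ → Ω → Fin n → ℝ} {ξ : ℕ → Ω → ℕ} (h : IsProbabilisticAttack μ p x0 w ξ) (i : ℕ) :
    ∫ ω, windowSign k (fun j => ξ j ω) i ∂μ = 2 * (1 - (p : ℝ)) ^ (2 * k - 1) - 1 := by
  have hset : {ω | ∀ l < 2 * k - 1, ξ (i + l) ω = 0} =
      ⋂ l ∈ Finset.range (2 * k - 1), ξ (i + l) ⁻¹' {0} := by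
    ext ω; simp
  have hm : MeasurableSet {ω | ∀ l < 2 * k - 1, ξ (i + l) ω = 0} := by
    rw [hset]
    exact Finset.measurableSet_biInter _ fun l _ =>
      h.measurable_time _ (measurableSet_singleton 0)
  have h0 : ∀ t, μ.real (ξ t ⁻¹' {0}) = 1 - p := by
    intro t
    have := (h.hasLaw t).map_eq
    rw [← map_measureReal_apply (h.measurable_time t) (measurableSet_singleton 0), this,
      bernoulliMeasure_real_apply_of_notMem_of_mem p (measurableSet_singleton 0) (by simp)
        (by simp)]
  unfold windowSign
  rw [integral_signIndicator hm, hset]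
  have hind := h.iIndep.precomp (add_right_injective i)
  have := hind.measure_inter_preimage_eq_mul (Finset.range (2 * k - 1)) (sets := fun _ => {0})
    (fun _ _ => measurableSet_singleton 0)
  rw [measureReal_def, this, ENNReal.toReal_prod]
  simp_rw [← measureReal_def, h0]
  simp

theorem attackTerm_eq_zero (A : Matrix (Fin n) (Fin n) ℝ) (C : Matrix (Fin r) (Fin n) ℝ)
    {w : ℕ → Fin n → ℝ} {x : ℕ → ℕ} (hw : ∀ t, x t = 0 → w t = 0) {i : ℕ}
    (hx : ∀ l < 2 * k - 1, x (i + l) = 0) :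
    attackTerm k A C w (2 * k - 1 + i) = 0 := by
  unfold attackTerm
  refine Finset.sum_eq_zero fun j hj => ?_
  rw [Finset.mem_range] at hj
  have : w (2 * k - 1 + i - 1 - j) = 0 := by
    apply hw
    have h := hx (2 * k - 1 - 1 - j) (by omega)
    rwa [show 2 * k - 1 + i - 1 - j = i + (2 * k - 1 - 1 - j) by omega]
  rw [this, Matrix.mulVec_zero]

/-- This trades a sign that depends on the attack values for one that depends on the attack times
alone. The shift `t = 2k - 1 + i` makes the window start at time `i`. -/
theorem windowSign_le_signIndicator (A : Matrix (Fin n) (Fin n) ℝ) (C : Matrix (Fin r) (Fin n) ℝ)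
    {w : ℕ → Fin n → ℝ} {x : ℕ → ℕ} (hw : ∀ t, x t = 0 → w t = 0) (i : ℕ) (e : Fin r) :
    windowSign k x i ≤ signIndicator (attackTerm k A C w (2 * k - 1 + i) e = 0) :=
  signIndicator_mono fun hx => by rw [attackTerm_eq_zero A C hw hx]; rfl

end AttackSign

theorem sum_Icc_window {M : Type*} [AddCommMonoid M] {k : ℕ} (hk : 1 ≤ k) (T : ℕ) (hT : 1 ≤ T)
    (f : ℕ → M) :
    ∑ t ∈ Finset.Icc (2 * k - 1) (T + 2 * k - 2), f t =
      ∑ i ∈ Finset.range T, f (2 * k - 1 + i) := by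
  have : Finset.Icc (2 * k - 1) (T + 2 * k - 2) = Finset.Ico (2 * k - 1) (T + (2 * k - 1)) := by
    ext t
    simp only [Finset.mem_Icc, Finset.mem_Ico]
    omega
  rw [this, Finset.sum_Ico_eq_sum_range]
  simp

/-! ### Deterministic exact recovery. -/

section Recovery

variable {n m r k T : ℕ} {A : Matrix (Fin n) (Fin n) ℝ} {B : Matrix (Fin n) (Fin m) ℝ}
  {C : Matrix (Fin r) (Fin n) ℝ} {D : Matrix (Fin r) (Fin m) ℝ}

theorem stateTraj_add (x0 : Fin n → ℝ) (u : ℕ → EuclideanSpace ℝ (Fin m)) (w : ℕ → Fin n → ℝ)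
    (t N : ℕ) :
    stateTraj A B x0 u w (t + N) = A ^ N *ᵥ stateTraj A B x0 u w t +
      ∑ j ∈ Finset.range N, A ^ j *ᵥ (B *ᵥ (u (t + N - 1 - j)).ofLp + w (t + N - 1 - j)) := by
  induction N with
  | zero => simp
  | succ N ih =>
    rw [← add_assoc, stateTraj, ih, Finset.sum_range_succ', Matrix.mulVec_add,
      Matrix.mulVec_mulVec, ← pow_succ', Matrix.mulVec_sum]
    have h : ∀ j, A *ᵥ (A ^ j *ᵥ (B *ᵥ (u (t + N - 1 - j)).ofLp + w (t + N - 1 - j))) =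
        A ^ (j + 1) *ᵥ (B *ᵥ (u (t + N + 1 - 1 - (j + 1))).ofLp +
          w (t + N + 1 - 1 - (j + 1))) := by
      intro j
      rw [Matrix.mulVec_mulVec, ← pow_succ', show t + N + 1 - 1 - (j + 1) = t + N - 1 - j by omega]
    simp only [h]
    simp [add_assoc]

/-- Unrolling the dynamics `2k - 1` steps back from `t` leaves the earlier state multiplied by
`A^(2k-1) = 0`. -/
theorem observation_eq (hk : 1 ≤ k) (hA : A ^ (2 * k - 1) = 0) (x0 : Fin n → ℝ)
    (u : ℕ → EuclideanSpace ℝ (Fin m)) (w : ℕ → Fin n → ℝ) {t : ℕ} (ht : 2 * k - 1 ≤ t) :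
    observation A B C D x0 u w t =
      markovMatrix k A B C D *ᵥ (stackedInput k u t).ofLp + attackTerm k A C w t := by
  obtain ⟨i, rfl⟩ := Nat.exists_eq_add_of_le ht
  obtain ⟨K, hK⟩ : ∃ K, 2 * k = K + 1 := ⟨2 * k - 1, by omega⟩
  have hG : markovMatrix k A B C D *ᵥ (stackedInput k u (2 * k - 1 + i)).ofLp =
      D *ᵥ (u (2 * k - 1 + i)).ofLp + ∑ j ∈ Finset.range (2 * k - 1),
        (C * A ^ j * B) *ᵥ (u (2 * k - 1 + i - 1 - j)).ofLp := by
    -- Splits off lag `0`, the block of `D`. The length is a variable so that it can be replaced by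
    -- a successor without casting `Fin (2 * k)`.
    have key : ∀ (L : ℕ) (hL : L = K + 1) (g : ℕ → ℝ), ∑ j : Fin L, g j =
        g 0 + ∑ j ∈ Finset.range (L - 1), g (j + 1) := by
      intro L hL g
      subst hL
      rw [Fin.sum_univ_eq_sum_range, Finset.sum_range_succ', add_comm, Nat.add_sub_cancel]
    ext e
    rw [Matrix.mulVec, dotProduct, Fintype.sum_prod_type]
    refine (key _ hK (fun j : ℕ => ∑ y : Fin m, (if j = 0 then D e y else
      (C * A ^ (j - 1) * B) e y) * (u (2 * k - 1 + i - j)).ofLp y)).trans ?_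
    simp only [Pi.add_apply, Finset.sum_apply, if_true, Nat.sub_zero, Nat.add_eq_zero_iff,
      one_ne_zero, and_false, if_false, Nat.add_sub_cancel]
    congr 1
    refine Finset.sum_congr rfl fun j _ => ?_
    rw [show 2 * k - 1 + i - (j + 1) = 2 * k - 1 + i - 1 - j by omega]
    rfl
  rw [hG, observation, add_comm (2 * k - 1) i, stateTraj_add, hA, Matrix.zero_mulVec, zero_add,
    Matrix.mulVec_sum, attackTerm]
  simp only [Matrix.mulVec_add, Finset.sum_add_distrib, Matrix.mulVec_mulVec, Matrix.mul_assoc]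
  abel

/-- Uncorrupted samples gain the full `|b|`, and corrupted ones lose at most `|b|`. -/
theorem signIndicator_mul_abs_le (a b : ℝ) : signIndicator (a = 0) * |b| ≤ |a - b| - |a| := by
  by_cases h : a = 0
  · simp [signIndicator, h]
  · have := abs_sub_abs_le_abs_sub a (a - b)
    simp only [signIndicator, h, if_false, sub_sub_cancel] at this ⊢
    linarith

theorem l1Solutions_eq_singleton {u : ℕ → EuclideanSpace ℝ (Fin m)} {y v : ℕ → Fin r → ℝ}
    {G₀ : Matrix (Fin r) (Fin (2 * k) × Fin m) ℝ}
    (hy : ∀ t, 2 * k - 1 ≤ t → y t = G₀ *ᵥ (stackedInput k u t).ofLp + v t)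
    (hpos : ∀ s : EuclideanSpace ℝ (Fin (2 * k) × Fin m), ‖s‖ = 1 → ∀ i : Fin r,
      0 < ∑ t ∈ Finset.Icc (2 * k - 1) (T + 2 * k - 2),
        signIndicator (v t i = 0) * |inner ℝ s (stackedInput k u t)|) :
    l1Solutions k T u y = {G₀} := by
  have hinner : ∀ (s : Fin (2 * k) × Fin m → ℝ) (t : ℕ),
      inner ℝ (WithLp.toLp 2 s) (stackedInput k u t) = s ⬝ᵥ (stackedInput k u t).ofLp := by
    intro s t
    simp [PiLp.inner_apply, dotProduct, mul_comm]
  have hrow : ∀ (s : Fin (2 * k) × Fin m → ℝ) (i : Fin r),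
      0 ≤ ∑ t ∈ Finset.Icc (2 * k - 1) (T + 2 * k - 2),
        signIndicator (v t i = 0) * |s ⬝ᵥ (stackedInput k u t).ofLp| ∧
      (s ≠ 0 → 0 < ∑ t ∈ Finset.Icc (2 * k - 1) (T + 2 * k - 2),
        signIndicator (v t i = 0) * |s ⬝ᵥ (stackedInput k u t).ofLp|) := by
    intro s i
    by_cases hs : s = 0
    · simp [hs]
    · have hs' : WithLp.toLp 2 s ≠ (0 : EuclideanSpace ℝ (Fin (2 * k) × Fin m)) := by
        simpa using hs
      -- Positive homogeneity extends the unit-sphere hypothesis to every nonzero row.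
      have hn : 0 < ‖WithLp.toLp 2 s‖ := norm_pos_iff.2 hs'
      have h1 := hpos (‖WithLp.toLp 2 s‖⁻¹ • WithLp.toLp 2 s)
        (by rw [norm_smul, norm_inv, norm_norm, inv_mul_cancel₀ hn.ne']) i
      have h2 : 0 < ∑ t ∈ Finset.Icc (2 * k - 1) (T + 2 * k - 2),
          signIndicator (v t i = 0) * |s ⬝ᵥ (stackedInput k u t).ofLp| := by
        have h3 := mul_pos hn h1
        rw [Finset.mul_sum] at h3
        refine h3.trans_eq (Finset.sum_congr rfl fun t _ => ?_)
        rw [real_inner_smul_left, abs_mul, abs_inv, abs_norm, hinner]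
        field_simp
      exact ⟨h2.le, fun _ => h2⟩
  have hdiff : ∀ G, ∑ i, ∑ t ∈ Finset.Icc (2 * k - 1) (T + 2 * k - 2),
      signIndicator (v t i = 0) * |(G - G₀) i ⬝ᵥ (stackedInput k u t).ofLp| ≤
        l1Loss k T u y G - l1Loss k T u y G₀ := by
    intro G
    rw [Finset.sum_comm, l1Loss, l1Loss, ← Finset.sum_sub_distrib]
    refine Finset.sum_le_sum fun t ht => ?_
    rw [← Finset.sum_sub_distrib]
    refine Finset.sum_le_sum fun i _ => ?_
    rw [hy t (Finset.mem_Icc.1 ht).1]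
    have h := signIndicator_mul_abs_le (v t i) ((G - G₀) i ⬝ᵥ (stackedInput k u t).ofLp)
    have e1 : (G - G₀) i ⬝ᵥ (stackedInput k u t).ofLp =
        (G *ᵥ (stackedInput k u t).ofLp) i - (G₀ *ᵥ (stackedInput k u t).ofLp) i := by
      rw [← Pi.sub_apply, ← Matrix.sub_mulVec]; rfl
    rw [e1] at h ⊢
    refine h.trans_eq ?_
    simp only [Pi.add_apply]
    congr 2 <;> ring
  ext G
  simp only [l1Solutions, Set.mem_ofPred_eq, Set.mem_singleton_iff]
  constructor
  · intro hG
    by_contra hne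
    have hex : ∃ i, (G - G₀) i ≠ 0 := by
      by_contra! h
      exact hne (sub_eq_zero.1 (funext h))
    obtain ⟨i, hi⟩ := hex
    have h1 := hdiff G
    have h2 := hG G₀
    have h3 := Finset.sum_pos' (fun i (_ : i ∈ Finset.univ) => (hrow ((G - G₀) i) i).1)
      ⟨i, Finset.mem_univ _, (hrow _ i).2 hi⟩
    linarith
  · rintro rfl G'
    have h1 := hdiff G'
    have h3 := Finset.sum_nonneg (fun i (_ : i ∈ Finset.univ) => (hrow ((G' - G) i) i).1)
    linarith

end Recovery

end

noncomputable section

/-! ### Concentration in a fixed direction. -/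

section FixedDirection

variable {Ω : Type*} [MeasurableSpace Ω] {μ : Measure Ω} [IsProbabilityMeasure μ] {n m k : ℕ}
  {p : unitInterval} {x0 : Ω → Fin n → ℝ} {w : ℕ → Ω → Fin n → ℝ} {ξ : ℕ → Ω → ℕ} {γ : ℝ}
  {u : ℕ → Ω → EuclideanSpace ℝ (Fin m)}

omit [IsProbabilityMeasure μ] in
theorem iIndepFun_comp_windows (hattack : IsProbabilisticAttack μ p x0 w ξ)
    (hinput : IsGaussianInput μ γ u) (hindep : IndepFun (fun ω t => u t ω) (fun ω t => ξ t ω) μ)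
    {L : ℕ} {Φ : (Fin L → EuclideanSpace ℝ (Fin m) × ℕ) → ℝ} (hΦ : Measurable Φ) (j : ℕ) :
    iIndepFun (fun a ω => Φ fun l => (u (j + L * a + l) ω, ξ (j + L * a + l) ω)) μ :=
  (iIndepFun_blocks (fun t => (hinput.measurable t).prodMk (hattack.measurable_time t))
    (iIndepFun_prodMk_of_indepFun hinput.measurable hattack.measurable_time hinput.iIndep
      hattack.iIndep hindep) L j).comp (fun _ => Φ) fun _ => hΦ

theorem measurable_windowSign {α : Type*} [MeasurableSpace α] {x : ℕ → α → ℕ}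
    (hx : ∀ t, Measurable (x t)) (k i : ℕ) :
    Measurable fun ω => windowSign k (fun t => x t ω) i := by
  refine measurable_signIndicator ?_
  have : {ω | ∀ l < 2 * k - 1, x (i + l) ω = 0} =
      ⋂ l ∈ Finset.range (2 * k - 1), x (i + l) ⁻¹' {0} := by
    ext ω; simp
  rw [this]
  exact Finset.measurableSet_biInter _ fun l _ => hx _ (measurableSet_singleton 0)

theorem inner_stackedInput_window (s : EuclideanSpace ℝ (Fin (2 * k) × Fin m))
    (v : ℕ → EuclideanSpace ℝ (Fin m)) (i : ℕ) :
    inner ℝ s (stackedInput k v (2 * k - 1 + i)) =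
      ∑ j, inner ℝ (lagBlock s j) (v (i + (Fin.rev j : Fin (2 * k)))) := by
  rw [inner_stackedInput]
  refine Finset.sum_congr rfl fun j _ => ?_
  rw [Fin.val_rev]
  congr 2
  omega

theorem measureReal_sum_windowSign_mul_abs_lt_le (hattack : IsProbabilisticAttack μ p x0 w ξ)
    (hinput : IsGaussianInput μ γ u) (hindep : IndepFun (fun ω t => u t ω) (fun ω t => ξ t ω) μ)
    (hk : 1 ≤ k) (hγ : 0 < γ) {β : ℝ} (hβ : β = 2 * (1 - (p : ℝ)) ^ (2 * k - 1) - 1)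
    (hβ0 : 0 ≤ β) (hβ1 : β ≤ 1) (T : ℕ) {s : EuclideanSpace ℝ (Fin (2 * k) × Fin m)}
    (hs : ‖s‖ = 1) :
    μ.real {ω | ∑ i ∈ Finset.range T, windowSign k (fun t => ξ t ω) i *
      |inner ℝ s (stackedInput k (fun t => u t ω) (2 * k - 1 + i))| < β / 6 * (γ * T)} ≤
      (2 * k : ℕ) * Real.exp (-(β ^ 2 / 144)) ^ (T / (2 * k)) := by
  have mu := hinput.measurable
  set Z : ℕ → Ω → ℝ := fun i ω =>
    inner ℝ s (stackedInput k (fun t => u t ω) (2 * k - 1 + i)) / γ with hZ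
  set X : ℕ → Ω → ℝ := fun i ω => windowSign k (fun t => ξ t ω) i * |Z i ω| - β / 6 with hX
  have hset : {ω | ∑ i ∈ Finset.range T, windowSign k (fun t => ξ t ω) i *
      |inner ℝ s (stackedInput k (fun t => u t ω) (2 * k - 1 + i))| < β / 6 * (γ * T)} =
      {ω | ∑ i ∈ Finset.range T, X i ω < 0} := by
    ext ω
    simp only [Set.mem_ofPred_eq, hX, hZ, abs_div, abs_of_pos hγ, Finset.sum_sub_distrib,
      Finset.sum_const, Finset.card_range, nsmul_eq_mul, ← mul_div_assoc, ← Finset.sum_div]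
    rw [sub_neg, div_lt_iff₀ hγ]
    ring_nf
  have mZ : ∀ i, Measurable (Z i) := by
    intro i
    simp only [hZ, inner_stackedInput]
    fun_prop
  have ma : ∀ i, Measurable fun ω => windowSign k (fun t => ξ t ω) i :=
    measurable_windowSign hattack.measurable_time k
  have hind : ∀ i, IndepFun (fun ω => windowSign k (fun t => ξ t ω) i) (Z i) μ := by
    intro i
    have h1 : Measurable fun x : ℕ → ℕ => windowSign k x i :=
      measurable_windowSign (fun t => measurable_pi_apply t) k i
    have h2 : Measurable fun v : ℕ → EuclideanSpace ℝ (Fin m) =>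
        inner ℝ s (stackedInput k v (2 * k - 1 + i)) / γ := by
      simp only [inner_stackedInput]
      fun_prop
    exact hindep.symm.comp h1 h2
  have hstep := fun i => mgf_sign_mul_abs_gaussian_le
    (hasLaw_inner_stackedInput hinput hγ (Nat.le_add_right _ i) hs) (ma i)
    (fun ω => signIndicator_eq_or _) (hind i) hβ0 hβ1 ((integral_windowSign hattack i).trans hβ.symm)
  rw [hset]
  refine measureReal_sum_neg_le (by omega) T (θ := β / 12) (fun i => ?_) (fun j => ?_)
    (by positivity) (Real.exp_le_one_iff.2 (neg_nonpos.2 (by positivity)))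
    (fun i => (hstep i).1) fun i => (hstep i).2
  · exact ((ma i).mul (mZ i).abs).sub_const _
  -- Each term is one fixed function of a block of length `2k`. The input uses the whole block in
  -- reversed order; the sign omits its last time, since `v_t` does not involve `w_t`.
  · set Φ : (Fin (2 * k) → EuclideanSpace ℝ (Fin m) × ℕ) → ℝ := fun b =>
      signIndicator (∀ l : Fin (2 * k), l.1 < 2 * k - 1 → (b l).2 = 0) *
        |(∑ j, inner ℝ (lagBlock s j) (b (Fin.rev j)).1) / γ| - β / 6 with hΦ
    have mΦ : Measurable Φ := by
      have h1 : Measurable fun b : Fin (2 * k) → EuclideanSpace ℝ (Fin m) × ℕ =>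
          signIndicator (∀ l : Fin (2 * k), l.1 < 2 * k - 1 → (b l).2 = 0) := by
        refine measurable_signIndicator ?_
        have : {b : Fin (2 * k) → EuclideanSpace ℝ (Fin m) × ℕ |
            ∀ l : Fin (2 * k), l.1 < 2 * k - 1 → (b l).2 = 0} =
            ⋂ l : Fin (2 * k), ⋂ _ : l.1 < 2 * k - 1, (fun b => (b l).2) ⁻¹' {0} := by
          ext b; simp
        rw [this]
        exact MeasurableSet.iInter fun l => MeasurableSet.iInter fun _ =>
          (measurable_pi_apply l).snd (measurableSet_singleton 0)
      fun_prop
    refine (iIndepFun_comp_windows hattack hinput hindep mΦ j).congr fun a => ?_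
    refine Filter.Eventually.of_forall fun ω => ?_
    simp only [hΦ, hX, hZ, inner_stackedInput_window, windowSign]
    congr 3
    refine propext ⟨fun h l hl => ?_, fun h l hl => h l hl⟩
    exact h ⟨l, by omega⟩ hl

/-- Applied to the coordinate vectors, this controls the cost of replacing a direction by a nearby
grid point. -/
theorem measureReal_lt_sum_abs_le (hattack : IsProbabilisticAttack μ p x0 w ξ)
    (hinput : IsGaussianInput μ γ u) (hindep : IndepFun (fun ω t => u t ω) (fun ω t => ξ t ω) μ)
    (hk : 1 ≤ k) (hγ : 0 < γ) (T : ℕ) {s : EuclideanSpace ℝ (Fin (2 * k) × Fin m)}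
    (hs : ‖s‖ = 1) :
    μ.real {ω | 3 * (γ * T) < ∑ i ∈ Finset.range T,
      |inner ℝ s (stackedInput k (fun t => u t ω) (2 * k - 1 + i))|} ≤
      (2 * k : ℕ) * Real.exp (-1) ^ (T / (2 * k)) := by
  have mu := hinput.measurable
  set Z : ℕ → Ω → ℝ := fun i ω =>
    inner ℝ s (stackedInput k (fun t => u t ω) (2 * k - 1 + i)) / γ with hZ
  set X : ℕ → Ω → ℝ := fun i ω => 3 - |Z i ω| with hX
  have hset : {ω | 3 * (γ * T) < ∑ i ∈ Finset.range T,
      |inner ℝ s (stackedInput k (fun t => u t ω) (2 * k - 1 + i))|} =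
      {ω | ∑ i ∈ Finset.range T, X i ω < 0} := by
    ext ω
    simp only [Set.mem_ofPred_eq, hX, hZ, abs_div, abs_of_pos hγ, Finset.sum_sub_distrib,
      Finset.sum_const, Finset.card_range, nsmul_eq_mul, ← Finset.sum_div]
    rw [sub_neg, lt_div_iff₀ hγ]
    ring_nf
  have mZ : ∀ i, Measurable (Z i) := by
    intro i
    simp only [hZ, inner_stackedInput]
    fun_prop
  have hstep := fun i => mgf_const_sub_abs_gaussian_le
    (hasLaw_inner_stackedInput hinput hγ (Nat.le_add_right _ i) hs)
  rw [hset]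
  refine measureReal_sum_neg_le (by omega) T (θ := 1) (fun i => (mZ i).abs.const_sub 3)
    (fun j => ?_) zero_le_one (Real.exp_le_one_iff.2 (by norm_num)) (fun i => (hstep i).1)
    fun i => (hstep i).2
  have mΦ : Measurable fun b : Fin (2 * k) → EuclideanSpace ℝ (Fin m) × ℕ =>
      3 - |(∑ j, inner ℝ (lagBlock s j) (b (Fin.rev j)).1) / γ| := by fun_prop
  refine (iIndepFun_comp_windows hattack hinput hindep mΦ j).congr fun a => ?_
  refine Filter.Eventually.of_forall fun ω => ?_
  simp only [hZ, inner_stackedInput_window]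

end FixedDirection

/-! ### Passage from a grid to the whole unit sphere. -/

section Net

variable {ι : Type*} [Fintype ι] [DecidableEq ι]

/-- The point of the grid of mesh `1 / N` with integer coordinates `g`. -/
def gridPoint (N : ℕ) (g : ι → ℤ) : EuclideanSpace ℝ ι :=
  WithLp.toLp 2 fun j => (g j : ℝ) / N

/-- The integer coordinates of the points of the grid of mesh `1 / N` in `[-1, 1]^ι`. -/
def gridCoords (ι : Type*) [Fintype ι] [DecidableEq ι] (N : ℕ) : Finset (ι → ℤ) :=
  Fintype.piFinset fun _ => Finset.Icc (-(N : ℤ)) N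

theorem card_gridCoords (N : ℕ) : (gridCoords ι N).card = (2 * N + 1) ^ Fintype.card ι := by
  rw [gridCoords, Fintype.card_piFinset]
  simp only [Int.card_Icc, Finset.prod_const, Finset.card_univ]
  congr 1
  omega

omit [DecidableEq ι] in
theorem abs_inner_le_mul_sum_abs {x y : EuclideanSpace ℝ ι} {h : ℝ} (hx : ∀ j, |x j| ≤ h) :
    |inner ℝ x y| ≤ h * ∑ j, |y j| := by
  rw [PiLp.inner_apply, Finset.mul_sum]
  refine (Finset.abs_sum_le_sum_abs _ _).trans (Finset.sum_le_sum fun j _ => ?_)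
  simp only [RCLike.inner_apply, conj_trivial, abs_mul]
  rw [mul_comm]
  exact mul_le_mul_of_nonneg_right (hx j) (abs_nonneg _)

theorem exists_gridCoords_near {N : ℕ} (hN : 0 < N) {s : EuclideanSpace ℝ ι} (hs : ‖s‖ = 1) :
    ∃ g ∈ gridCoords ι N, ∀ j, |(s - gridPoint N g) j| ≤ 1 / N := by
  have hN' : (0 : ℝ) < N := by exact_mod_cast hN
  refine ⟨fun j => ⌊s j * N⌋, ?_, fun j => ?_⟩
  · rw [gridCoords, Fintype.mem_piFinset]
    intro j
    have hj : |s j| ≤ 1 := by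
      have := PiLp.norm_apply_le s j
      rwa [hs, Real.norm_eq_abs] at this
    rw [abs_le] at hj
    rw [Finset.mem_Icc]
    constructor
    · rw [Int.le_floor]
      push_cast
      nlinarith
    · have : (⌊s j * N⌋ : ℝ) ≤ N := (Int.floor_le _).trans (by nlinarith)
      exact_mod_cast this
  · have h1 := Int.floor_le (s j * N)
    have h2 := Int.lt_floor_add_one (s j * N)
    have h3 : (s - gridPoint N fun j => ⌊s j * N⌋) j = (s j * N - ⌊s j * N⌋) / N := by
      simp only [PiLp.sub_apply, gridPoint]
      field_simp
    rw [h3, abs_div, abs_of_pos hN']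
    gcongr
    rw [abs_le]
    constructor <;> linarith

/-- Round `s` to a grid point `x` within `1/2` of it. Then `‖x‖ ≥ 1/2`, so undoing the normalization
of `x` costs at most half of `τ`; moving from `x` to `s` costs at most `1/N` times the sum of all
coordinates in absolute value. -/
theorem le_sum_mul_abs_inner_of_grid {N T : ℕ} (hN : 0 < N)
    (hdN : (Fintype.card ι : ℝ) / N ≤ 1 / 2) {a : ℕ → ℝ} (ha : ∀ i, |a i| = 1)
    {U : ℕ → EuclideanSpace ℝ ι} {τ M : ℝ} (hτ : 0 ≤ τ)
    (hgrid : ∀ g ∈ gridCoords ι N, gridPoint N g ≠ 0 → τ ≤ ∑ i ∈ Finset.range T,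
      a i * |inner ℝ (‖gridPoint N g‖⁻¹ • gridPoint N g) (U i)|)
    (hcoord : ∀ j, ∑ i ∈ Finset.range T, |inner ℝ (EuclideanSpace.single j 1) (U i)| ≤ M)
    {s : EuclideanSpace ℝ ι} (hs : ‖s‖ = 1) :
    τ / 2 - (Fintype.card ι : ℝ) / N * M ≤ ∑ i ∈ Finset.range T, a i * |inner ℝ s (U i)| := by
  have hN' : (0 : ℝ) < N := by exact_mod_cast hN
  obtain ⟨g, hg, hnear⟩ := exists_gridCoords_near hN hs
  set x := gridPoint N g
  have hdist : ‖s - x‖ ≤ 1 / 2 := by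
    refine le_trans (abs_le_of_sq_le_sq' ?_ (by positivity)).2 hdN
    rw [EuclideanSpace.norm_sq_eq]
    calc ∑ j, ‖(s - x) j‖ ^ 2 ≤ ∑ _j : ι, (1 / (N : ℝ)) ^ 2 := by
          refine Finset.sum_le_sum fun j _ => ?_
          exact pow_le_pow_left₀ (norm_nonneg _) (hnear j) 2
      _ = Fintype.card ι * (1 / (N : ℝ)) ^ 2 := by simp
      _ ≤ (Fintype.card ι : ℝ) ^ 2 * (1 / (N : ℝ)) ^ 2 := by
          gcongr
          exact_mod_cast Nat.le_self_pow two_ne_zero _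
      _ = _ := by ring
  have hnorm : 1 / 2 ≤ ‖x‖ := by
    have := norm_sub_norm_le s x
    linarith
  have hx0 : x ≠ 0 := norm_pos_iff.1 (by linarith)
  have hxpos : 0 < ‖x‖ := norm_pos_iff.2 hx0
  have h1 : τ / 2 ≤ ∑ i ∈ Finset.range T, a i * |inner ℝ x (U i)| := by
    calc τ / 2 ≤ ‖x‖ * τ := by nlinarith
      _ ≤ ‖x‖ * ∑ i ∈ Finset.range T, a i * |inner ℝ (‖x‖⁻¹ • x) (U i)| :=
          mul_le_mul_of_nonneg_left (hgrid g hg hx0) hxpos.le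
      _ = _ := by
          rw [Finset.mul_sum]
          refine Finset.sum_congr rfl fun i _ => ?_
          rw [real_inner_smul_left, abs_mul, abs_inv, abs_norm]
          field_simp
  have h2 : ∑ i ∈ Finset.range T, (a i * |inner ℝ x (U i)| - a i * |inner ℝ s (U i)|) ≤
      (Fintype.card ι : ℝ) / N * M := by
    calc _ ≤ ∑ i ∈ Finset.range T, 1 / (N : ℝ) * ∑ j, |U i j| := by
          refine Finset.sum_le_sum fun i _ => ?_
          refine le_trans ?_ (abs_inner_le_mul_sum_abs (y := U i) hnear)
          rw [← mul_sub, inner_sub_left, abs_sub_comm]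
          refine (le_abs_self _).trans ?_
          rw [abs_mul, ha, one_mul]
          exact abs_abs_sub_abs_le _ _
      _ = 1 / (N : ℝ) * ∑ j, ∑ i ∈ Finset.range T, |U i j| := by
          rw [← Finset.mul_sum, Finset.sum_comm]
      _ ≤ 1 / (N : ℝ) * ∑ _j : ι, M := by
          gcongr with j
          simpa [EuclideanSpace.inner_single_left] using hcoord j
      _ = _ := by simp; ring
  rw [Finset.sum_sub_distrib] at h2
  linarith

end Net

/-! ### Arithmetic of the union bound. -/

section Constants

theorem union_bound_le {k m r T : ℕ} (hk : 1 ≤ k) (hm : 1 ≤ m) (hr : 1 ≤ r) {β δ : ℝ}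
    (hβ0 : 0 < β) (hβ1 : β ≤ 1) (hδ0 : 0 < δ) (hδ1 : δ ≤ 1)
    (hT : 23040 * ((k : ℝ) / β ^ 2 * max 1 ((k : ℝ) * m * Real.log ((k : ℝ) * m / β)
      + Real.log ((r : ℝ) / δ))) ≤ T) {N : ℕ} (hN : N = ⌈72 * ((2 * k * m : ℕ) : ℝ) / β⌉₊) :
    ((2 * N + 1 : ℕ) ^ (2 * k * m) + (2 * k * m : ℕ) : ℝ) *
      ((2 * k : ℕ) * Real.exp (-(β ^ 2 / 144)) ^ (T / (2 * k))) ≤ δ := by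
  set ℓ := Real.log ((k : ℝ) * m / β) with hℓ
  set M := max 1 ((k : ℝ) * m * ℓ + Real.log ((r : ℝ) / δ)) with hM
  have hk1 : (1 : ℝ) ≤ k := by exact_mod_cast hk
  have hm1 : (1 : ℝ) ≤ m := by exact_mod_cast hm
  have hr1 : (1 : ℝ) ≤ r := by exact_mod_cast hr
  have hkm1 : (1 : ℝ) ≤ (k : ℝ) * m := one_le_mul_of_one_le_of_one_le hk1 hm1
  have hkmβ : (k : ℝ) * m ≤ (k : ℝ) * m / β := by
    rw [le_div_iff₀ hβ0]; nlinarith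
  have hℓ0 : 0 ≤ ℓ := Real.log_nonneg (hkm1.trans hkmβ)
  have hrδ : 1 ≤ (r : ℝ) / δ := by rw [le_div_iff₀ hδ0]; linarith
  have hlog0 : 0 ≤ Real.log ((r : ℝ) / δ) := Real.log_nonneg hrδ
  have hM1 : 1 ≤ M := le_max_left _ _
  have hM2 : (k : ℝ) * m * ℓ + Real.log ((r : ℝ) / δ) ≤ M := le_max_right _ _
  have hkmℓ0 : 0 ≤ (k : ℝ) * m * ℓ := by positivity
  -- The logarithm can vanish when `km = 1`, where `M ≥ 1` suffices; for `km ≥ 2` it is at least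
  -- `log 2 ≥ 1/2`.
  have hkmM : (k : ℝ) * m ≤ 2 * M := by
    rcases Nat.lt_or_ge (k * m) 2 with h | h
    · have : ((k * m : ℕ) : ℝ) ≤ 1 := by exact_mod_cast Nat.lt_succ_iff.1 h
      push_cast at this
      linarith
    · have h2 : (2 : ℝ) ≤ (k : ℝ) * m := by exact_mod_cast h
      have h3 : 1 / 2 ≤ ℓ := by
        have h4 : Real.log 2 ≤ ℓ := Real.log_le_log two_pos (h2.trans hkmβ)
        have := Real.log_two_gt_d9
        linarith
      nlinarith
  have hkM : (k : ℝ) ≤ 2 * M := le_trans (by nlinarith) hkmM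
  -- the number of windows
  have hTk : 2 * k ≤ T := by
    have h1 : (k : ℝ) ≤ (k : ℝ) / β ^ 2 := by
      rw [le_div_iff₀ (by positivity)]
      have : β ^ 2 ≤ 1 := pow_le_one₀ hβ0.le hβ1
      nlinarith
    have h2 : (k : ℝ) / β ^ 2 ≤ (k : ℝ) / β ^ 2 * M := le_mul_of_one_le_right (by positivity) hM1
    have : ((2 * k : ℕ) : ℝ) ≤ T := by push_cast; linarith
    exact_mod_cast this
  have hdiv : (T : ℝ) ≤ 4 * k * (T / (2 * k) : ℕ) := by
    have h1 : 1 ≤ T / (2 * k) := (Nat.one_le_div_iff (by omega)).2 hTk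
    have h2 := Nat.div_add_mod T (2 * k)
    have h3 := Nat.mod_lt T (show 2 * k > 0 by omega)
    have : T ≤ 4 * k * (T / (2 * k)) := by nlinarith
    exact_mod_cast this
  -- The constant is `23040 = 144 · 4 · 40`: the rate `1/144`, the loss `T / (2k) ≥ T/(4k)` from
  -- integer division, and the target exponent. The net takes `26M` and the factor `4k` takes `8M`,
  -- leaving `-6M`.
  have hexp : Real.exp (-(β ^ 2 / 144)) ^ (T / (2 * k)) ≤ Real.exp (-(40 * M)) := by
    rw [← Real.exp_nat_mul, Real.exp_le_exp]
    have h1 : 23040 * (k : ℝ) * M ≤ T * β ^ 2 := by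
      have := mul_le_mul_of_nonneg_right hT (sq_nonneg β)
      calc 23040 * (k : ℝ) * M = 23040 * ((k : ℝ) / β ^ 2 * M) * β ^ 2 := by field_simp
        _ ≤ _ := this
    have h2 : T * β ^ 2 ≤ 4 * k * (T / (2 * k) : ℕ) * β ^ 2 :=
      mul_le_mul_of_nonneg_right hdiv (sq_nonneg β)
    have h3 : 4 * (k : ℝ) * (5760 * M) ≤ 4 * k * ((T / (2 * k) : ℕ) * β ^ 2) := by linarith
    have h4 := le_of_mul_le_mul_left h3 (by positivity)
    linarith
  -- the size of the net
  have hNle : ((2 * N + 1 : ℕ) : ℝ) ≤ Real.exp (6 + ℓ) := by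
    have h1 : (N : ℝ) < 72 * ((2 * k * m : ℕ) : ℝ) / β + 1 := by
      rw [hN]; exact Nat.ceil_lt_add_one (by positivity)
    have h2 : (294 : ℝ) ≤ Real.exp 6 := by
      have h := Real.exp_one_gt_d9
      have h3 : Real.exp 6 = Real.exp 1 ^ 6 := by rw [← Real.exp_nat_mul]; norm_num
      rw [h3]
      calc (294 : ℝ) ≤ 2.7 ^ 6 := by norm_num
        _ ≤ Real.exp 1 ^ 6 := by gcongr; linarith
    have h4 : Real.exp ℓ = (k : ℝ) * m / β := Real.exp_log (by positivity)
    rw [Real.exp_add, h4]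
    have h5 : 72 * ((2 * k * m : ℕ) : ℝ) / β = 144 * ((k : ℝ) * m / β) := by push_cast; ring
    rw [h5] at h1
    have h6 : 294 * ((k : ℝ) * m / β) ≤ Real.exp 6 * ((k : ℝ) * m / β) := by gcongr
    push_cast
    linarith [hkm1.trans hkmβ]
  have hcard : ((2 * N + 1 : ℕ) : ℝ) ^ (2 * k * m) ≤ Real.exp (26 * M) := by
    calc ((2 * N + 1 : ℕ) : ℝ) ^ (2 * k * m) ≤ Real.exp (6 + ℓ) ^ (2 * k * m) := by gcongr
      _ = Real.exp (12 * ((k : ℝ) * m) + 2 * ((k : ℝ) * m * ℓ)) := by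
          rw [← Real.exp_nat_mul]; push_cast; ring_nf
      _ ≤ Real.exp (26 * M) := by rw [Real.exp_le_exp]; linarith
  have hd : ((2 * k * m : ℕ) : ℝ) ≤ Real.exp (26 * M) := by
    have := Real.add_one_le_exp (26 * M)
    push_cast
    linarith
  have h4k : 4 * (k : ℝ) ≤ Real.exp (8 * M) := by
    have := Real.add_one_le_exp (8 * M)
    linarith
  calc ((2 * N + 1 : ℕ) ^ (2 * k * m) + (2 * k * m : ℕ) : ℝ) *
      ((2 * k : ℕ) * Real.exp (-(β ^ 2 / 144)) ^ (T / (2 * k)))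
      ≤ (Real.exp (26 * M) + Real.exp (26 * M)) * ((2 * k : ℕ) * Real.exp (-(40 * M))) := by
        gcongr
    _ = Real.exp (26 * M) * (4 * k) * Real.exp (-(40 * M)) := by push_cast; ring
    _ ≤ Real.exp (26 * M) * Real.exp (8 * M) * Real.exp (-(40 * M)) := by gcongr
    _ = Real.exp (-(6 * M)) := by rw [← Real.exp_add, ← Real.exp_add]; ring_nf
    _ ≤ Real.exp (-Real.log ((r : ℝ) / δ)) := by rw [Real.exp_le_exp]; linarith
    _ = δ / r := by rw [Real.exp_neg, Real.exp_log (by positivity), inv_div]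
    _ ≤ δ := div_le_self hδ0.le hr1

end Constants

end

noncomputable section

/-! ### Uniform lower bound over the unit sphere. -/

section Uniform

theorem le_measureReal_uniform_lower_bound {Ω : Type*} [MeasurableSpace Ω] {μ : Measure Ω}
    [IsProbabilityMeasure μ] {n m r k T : ℕ} {p : unitInterval} {x0 : Ω → Fin n → ℝ}
    {w : ℕ → Ω → Fin n → ℝ} {ξ : ℕ → Ω → ℕ} {γ : ℝ} {u : ℕ → Ω → EuclideanSpace ℝ (Fin m)}
    (hattack : IsProbabilisticAttack μ p x0 w ξ)
    (hinput : IsGaussianInput μ γ u) (hindep : IndepFun (fun ω t => u t ω) (fun ω t => ξ t ω) μ)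
    (hk : 1 ≤ k) (hm : 1 ≤ m) (hr : 1 ≤ r) (hγ : 0 < γ) {β δ : ℝ}
    (hβ : β = 2 * (1 - (p : ℝ)) ^ (2 * k - 1) - 1) (hβ0 : 0 < β) (hβ1 : β ≤ 1)
    (hδ0 : 0 < δ) (hδ1 : δ ≤ 1)
    (hT : 23040 * ((k : ℝ) / β ^ 2 * max 1 ((k : ℝ) * m * Real.log ((k : ℝ) * m / β)
      + Real.log ((r : ℝ) / δ))) ≤ T) :
    1 - δ ≤ μ.real {ω | ∀ s : EuclideanSpace ℝ (Fin (2 * k) × Fin m), ‖s‖ = 1 →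
      1 / 24 * (γ * β * T) ≤ ∑ i ∈ Finset.range T, windowSign k (fun t => ξ t ω) i *
        |inner ℝ s (stackedInput k (fun t => u t ω) (2 * k - 1 + i))|} := by
  classical
  -- This mesh bounds the rounding loss by `(β/72) · 3γT = βγT/24`, half of the `βγT/12` kept from
  -- the grid; the other half gives the constant `1/24`.
  set N : ℕ := ⌈72 * ((2 * k * m : ℕ) : ℝ) / β⌉₊ with hN
  set P : ℝ := (2 * k : ℕ) * Real.exp (-(β ^ 2 / 144)) ^ (T / (2 * k)) with hP
  have hcard : Fintype.card (Fin (2 * k) × Fin m) = 2 * k * m := by simp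
  have hd : (0 : ℝ) < (2 * k * m : ℕ) := by
    exact_mod_cast Nat.mul_pos (Nat.mul_pos two_pos hk) hm
  have hNge : 72 * ((2 * k * m : ℕ) : ℝ) / β ≤ N := Nat.le_ceil _
  have hN0 : 0 < N := Nat.ceil_pos.2 (by positivity)
  have hN0' : (0 : ℝ) < N := by exact_mod_cast hN0
  have hdN : ((2 * k * m : ℕ) : ℝ) / N ≤ β / 72 := by
    rw [div_le_iff₀ hβ0] at hNge
    rw [div_le_div_iff₀ hN0' (by norm_num)]
    linarith
  set grid := gridCoords (Fin (2 * k) × Fin m) N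
  set bad₁ : (Fin (2 * k) × Fin m → ℤ) → Set Ω := fun g =>
    {ω | ∑ i ∈ Finset.range T, windowSign k (fun t => ξ t ω) i *
      |inner ℝ (‖gridPoint N g‖⁻¹ • gridPoint N g)
        (stackedInput k (fun t => u t ω) (2 * k - 1 + i))| < β / 6 * (γ * T)} with hbad₁
  set bad₂ : Fin (2 * k) × Fin m → Set Ω := fun j =>
    {ω | 3 * (γ * T) < ∑ i ∈ Finset.range T, |inner ℝ (EuclideanSpace.single j (1 : ℝ))
      (stackedInput k (fun t => u t ω) (2 * k - 1 + i))|} with hbad₂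
  set good : Set Ω := {ω | ∀ s : EuclideanSpace ℝ (Fin (2 * k) × Fin m), ‖s‖ = 1 →
      1 / 24 * (γ * β * T) ≤ ∑ i ∈ Finset.range T, windowSign k (fun t => ξ t ω) i *
        |inner ℝ s (stackedInput k (fun t => u t ω) (2 * k - 1 + i))|} with hgood
  set S := grid.filter fun g => gridPoint N g ≠ 0 with hS
  -- Covering the whole space and using subadditivity needs no measurability of `good`, which is an
  -- uncountable intersection.
  have hcover : (Set.univ : Set Ω) ⊆
      ((⋃ g ∈ S, bad₁ g) ∪ ⋃ j ∈ (Finset.univ : Finset (Fin (2 * k) × Fin m)), bad₂ j) ∪ good := by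
    intro ω _
    by_contra hω
    simp only [Set.mem_union, Set.mem_iUnion, not_or, not_exists] at hω
    obtain ⟨⟨h1, h2⟩, h3⟩ := hω
    refine h3 fun s hs => ?_
    have hhalf : (Fintype.card (Fin (2 * k) × Fin m) : ℝ) / N ≤ 1 / 2 := by
      rw [hcard]
      linarith
    have key := le_sum_mul_abs_inner_of_grid hN0 hhalf (T := T)
      (a := fun i => windowSign k (fun t => ξ t ω) i) (fun i => abs_signIndicator _)
      (U := fun i => stackedInput k (fun t => u t ω) (2 * k - 1 + i))
      (τ := β / 6 * (γ * T)) (M := 3 * (γ * T)) (by positivity)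
      (fun g hg hg0 => not_lt.1 (h1 g (Finset.mem_filter.2 ⟨hg, hg0⟩)))
      (fun j => not_lt.1 (h2 j (Finset.mem_univ j))) hs
    refine le_trans ?_ key
    rw [hcard]
    have : ((2 * k * m : ℕ) : ℝ) / N * (3 * (γ * T)) ≤ β / 72 * (3 * (γ * T)) := by gcongr
    linarith
  have hP₁ : ∀ g ∈ S, μ.real (bad₁ g) ≤ P := by
    intro g hg
    have hg0 : gridPoint N g ≠ 0 := (Finset.mem_filter.1 hg).2
    refine measureReal_sum_windowSign_mul_abs_lt_le hattack hinput hindep hk hγ hβ hβ0.le hβ1 T ?_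
    rw [norm_smul, norm_inv, norm_norm, inv_mul_cancel₀ (norm_ne_zero_iff.2 hg0)]
  have hP₂ : ∀ j ∈ (Finset.univ : Finset (Fin (2 * k) × Fin m)), μ.real (bad₂ j) ≤ P := by
    intro j _
    refine (measureReal_lt_sum_abs_le hattack hinput hindep hk hγ T (by simp)).trans ?_
    have : Real.exp (-1) ≤ Real.exp (-(β ^ 2 / 144)) := by
      rw [Real.exp_le_exp]
      nlinarith
    rw [hP]
    gcongr
  have hP0 : 0 ≤ P := by positivity
  have hbad : μ.real ((⋃ g ∈ S, bad₁ g) ∪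
      ⋃ j ∈ (Finset.univ : Finset (Fin (2 * k) × Fin m)), bad₂ j) ≤ δ := by
    refine le_trans ?_ (union_bound_le hk hm hr hβ0 hβ1 hδ0 hδ1 hT hN)
    rw [add_mul]
    refine (measureReal_union_le _ _).trans (add_le_add ?_ ?_)
    · refine (measureReal_biUnion_finset_le _ _).trans ((Finset.sum_le_sum hP₁).trans ?_)
      rw [Finset.sum_const, nsmul_eq_mul]
      refine mul_le_mul_of_nonneg_right ?_ hP0
      have h1 : S.card ≤ (2 * N + 1) ^ (2 * k * m) := by
        refine (Finset.card_filter_le _ _).trans_eq ?_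
        rw [card_gridCoords, hcard]
      exact_mod_cast h1
    · refine (measureReal_biUnion_finset_le _ _).trans ((Finset.sum_le_sum hP₂).trans_eq ?_)
      rw [Finset.sum_const, nsmul_eq_mul, Finset.card_univ, hcard]
  have h1 : (1 : ℝ) ≤ μ.real (Set.univ : Set Ω) := by simp
  have h2 := h1.trans (measureReal_mono hcover (measure_ne_top _ _))
  have h3 := h2.trans (measureReal_union_le _ _)
  linarith

/-- Bernoulli's inequality gives `(1 - p)^(2k-1) ≥ 1 - (2k-1)p`; the threshold on `p` is where this
equals `1/2`. -/
theorem half_lt_one_sub_pow {k : ℕ} (hk : 1 ≤ k) {p : ℝ} (hp1 : p ≤ 1)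
    (hp : p < 1 / (4 * (k : ℝ) - 2)) : 1 / 2 < (1 - p) ^ (2 * k - 1) := by
  have hk1 : (1 : ℝ) ≤ k := by exact_mod_cast hk
  have hb := one_add_mul_le_pow (a := -p) (by linarith) (2 * k - 1)
  rw [← sub_eq_add_neg] at hb
  have hcast : ((2 * k - 1 : ℕ) : ℝ) = 2 * k - 1 := by
    rw [Nat.cast_sub (by omega)]; push_cast; ring
  rw [hcast] at hb
  rw [lt_div_iff₀ (by linarith)] at hp
  linarith

end Uniform

end

theorem theorem2 :
    ∃ K > (0 : ℝ), ∃ c > (0 : ℝ),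
      ∀ (n m r k T : ℕ) (_hm : 1 ≤ m) (_hr : 1 ≤ r) (_hk : 1 ≤ k)
        (A : Matrix (Fin n) (Fin n) ℝ) (B : Matrix (Fin n) (Fin m) ℝ)
        (C : Matrix (Fin r) (Fin n) ℝ) (D : Matrix (Fin r) (Fin m) ℝ)
        (p : unitInterval) (_hp : (p : ℝ) < 1 / (4 * (k : ℝ) - 2))
        (q : ℝ) (_hq : q = 1 - (1 - (p : ℝ)) ^ (2 * k - 1))
        (γ : ℝ) (_hγ : 0 < γ) (δ : ℝ) (_hδ : δ ∈ Set.Ioc (0 : ℝ) 1)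
        (Ω : Type*) [MeasurableSpace Ω] (μ : Measure Ω) [IsProbabilityMeasure μ]
        (x0 : Ω → Fin n → ℝ) (w : ℕ → Ω → Fin n → ℝ) (ξ : ℕ → Ω → ℕ)
        (u : ℕ → Ω → EuclideanSpace ℝ (Fin m))
        (_hattack : IsProbabilisticAttack μ p x0 w ξ)
        (_hinput : IsGaussianInput μ γ u)
        (_hindep : IndepFun (fun ω t => u t ω) (fun ω t => ξ t ω) μ)
        (_hT : K * ((k : ℝ) / (1 - 2 * q) ^ 2 *
            max 1 ((k : ℝ) * m * Real.log ((k : ℝ) * m / (1 - 2 * q))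
              + Real.log ((r : ℝ) / δ))) ≤ (T : ℝ)),
        0 < c * (γ * (1 - 2 * q) * T) ∧
        1 - δ ≤ μ.real {ω |
          (∀ s : EuclideanSpace ℝ (Fin (2 * k) × Fin m), ‖s‖ = 1 → ∀ i : Fin r,
            c * (γ * (1 - 2 * q) * T) ≤
              ∑ t ∈ Finset.Icc (2 * k - 1) (T + 2 * k - 2),
                signIndicator (attackTerm k A C (fun j => w j ω) t i = 0) *
                  |inner ℝ s (stackedInput k (fun j => u j ω) t)|) ∧
          (A ^ (2 * k - 1) = 0 →
            l1Solutions k T (fun j => u j ω)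
                (observation A B C D (x0 ω) (fun j => u j ω) (fun j => w j ω)) =
              {markovMatrix k A B C D})} := by
  refine ⟨23040, by norm_num, 1 / 24, by norm_num, ?_⟩
  intro n m r k T hm hr hk A B C D p hp q hq γ hγ δ hδ Ω _ μ _ x0 w ξ u hattack hinput hindep hT
  have hpow1 : (1 - (p : ℝ)) ^ (2 * k - 1) ≤ 1 :=
    pow_le_one₀ (by linarith [p.2.2]) (by linarith [p.2.1])
  have hpow2 := half_lt_one_sub_pow hk p.2.2 hp
  have hβ : 1 - 2 * q = 2 * (1 - (p : ℝ)) ^ (2 * k - 1) - 1 := by rw [hq]; ring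
  have hβ0 : 0 < 1 - 2 * q := by linarith
  have hβ1 : 1 - 2 * q ≤ 1 := by linarith
  have hTpos : (0 : ℝ) < T := by
    have hk0 : (0 : ℝ) < k := by exact_mod_cast hk
    have hmax : (0 : ℝ) < max 1 ((k : ℝ) * m * Real.log ((k : ℝ) * m / (1 - 2 * q))
        + Real.log ((r : ℝ) / δ)) := lt_max_of_lt_left one_pos
    exact lt_of_lt_of_le (by positivity) hT
  have hT1 : 1 ≤ T := Nat.one_le_iff_ne_zero.2 (by rintro rfl; simp at hTpos)
  have hpos : 0 < 1 / 24 * (γ * (1 - 2 * q) * T) := by positivity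
  refine ⟨hpos, ?_⟩
  refine (le_measureReal_uniform_lower_bound hattack hinput hindep hk hm hr hγ hβ hβ0 hβ1 hδ.1
    hδ.2 hT).trans (measureReal_mono (fun ω hω => ?_) (measure_ne_top _ _))
  have hsum : ∀ s : EuclideanSpace ℝ (Fin (2 * k) × Fin m), ‖s‖ = 1 → ∀ i : Fin r,
      1 / 24 * (γ * (1 - 2 * q) * T) ≤ ∑ t ∈ Finset.Icc (2 * k - 1) (T + 2 * k - 2),
        signIndicator (attackTerm k A C (fun j => w j ω) t i = 0) *
          |inner ℝ s (stackedInput k (fun j => u j ω) t)| := by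
    intro s hs i
    rw [sum_Icc_window hk T hT1]
    -- The comparison of signs is pathwise, so one good event covers all rows `i` with no union over
    -- them.
    refine (hω s hs).trans (Finset.sum_le_sum fun t _ => ?_)
    exact mul_le_mul_of_nonneg_right
      (windowSign_le_signIndicator A C (fun t h => hattack.eq_zero t ω h) t i) (abs_nonneg _)
  exact ⟨hsum, fun hA => l1Solutions_eq_singleton
    (fun t ht => observation_eq hk hA (x0 ω) _ _ ht) fun s hs i => hpos.trans_le (hsum s hs i)⟩
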